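/- All graphs are finite, simple and undirected; $u\sim v$ denotes adjacency. For graphs $G$ and $H$, the categorical product $G\times H$ has vertex set $V(G)\times V(H)$, with $(u_1,v_1)\sim(u_2,v_2)$ if and only if $u_1\sim u_2$ in $G$ and $v_1\sim v_2$ in $H$. The strict vector chromatic number $\bar\vartheta(G)$ is the infimum of the real numbers $k>1$ for which there are a $d\ge 0$ and a map $\varphi$ from $V(G)$ to the unit sphere of $\mathbb{R}^{d+1}$ with $\varphi(u)^T\varphi(v)=-\frac{1}{k-1}$ whenever $u\sim v$. The quantum chromatic number $\chi_q(G)$ is the least integer $n\ge 0$ for which there are an integer $d\ge 1$ and, for every $u\in V(G)$, orthogonal projectors $E_{u,1},\dots,E_{u,n}\in\mathbb{C}^{d\times d}$ with $\sum_{i=1}^n E_{u,i}=I$, such that $E_{u,i}E_{v,i}=0$ for all $i$ whenever $u\sim v$. (That is, there is a homomorphism from $G$ to the graph $M(K_n,d)$, where for a graph $K$ the vertices of $M(K,d)$ are the tuples $(E_x)_{x\in V(K)}$ of orthogonal projectors in $\mathbb{C}^{d\times d}$ with sum $I$, and $(E_x)$ and $(E'_x)$ are adjacent if $E_xE'_y=0$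 whenever $x\not\sim y$, in particular for $x=y$.) **Theorem.** Let $G$ and $H$ be graphs such that $\chi_q(G)=\bar\vartheta(G)$ and $\chi_q(H)=\bar\vartheta(H)$. Then $$\chi_q(G\times H)=\min\{\chi_q(G),\chi_q(H)\}.$$ -/

import Mathlib

namespace HomProducts

/-- The categorical (direct, tensor) product of two graphs. -/
def catProd {V W : Type*} (G : SimpleGraph V) (H : SimpleGraph W) : SimpleGraph (V × W) where
  Adj p q := G.Adj p.1 q.1 ∧ H.Adj p.2 q.2
  symm := ⟨fun _ _ h => ⟨h.1.symm, h.2.symm⟩⟩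
  loopless := ⟨fun p h => G.loopless.irrefl p.1 h.1⟩

/-- `φ : V → 𝒮ᵈ ⊆ ℝᵈ⁺¹` is a strict vector `k`-coloring of `G`. -/
def IsStrictVectorColoring {V : Type*} (G : SimpleGraph V) (k : ℝ) {d : ℕ}
    (φ : V → Metric.sphere (0 : EuclideanSpace ℝ (Fin (d + 1))) 1) : Prop :=
  ∀ u v, G.Adj u v →
    inner ℝ (φ u : EuclideanSpace ℝ (Fin (d + 1))) (φ v) = -(1 / (k - 1))

/-- The strict vector chromatic number: the infimum of the reals `k > 1` such that `G` has a
strict vector `k`-coloring (in some dimension). -/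
noncomputable def strictVectorChromaticNumber {V : Type*} (G : SimpleGraph V) : ℝ :=
  sInf {k : ℝ | 1 < k ∧ ∃ (d : ℕ) (φ : V → Metric.sphere (0 : EuclideanSpace ℝ (Fin (d + 1))) 1),
    IsStrictVectorColoring G k φ}

/-- Projective measurements on `ℂᵈ` with outcomes in `V`: tuples of orthogonal projectors
(self-adjoint idempotent matrices) that sum to the identity. -/
structure ProjMeasurement (V : Type*) [Fintype V] (d : ℕ) where
  /-- The projector of each outcome. -/
  proj : V → Matrix (Fin d) (Fin d) ℂ
  isProj : ∀ v, IsStarProjection (proj v)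
  sum_eq_one : ∑ v, proj v = 1

/-- The measurement graph `M(G, d)`, for `d ≥ 1`. -/
def measurementGraph {V : Type*} [Fintype V] (G : SimpleGraph V) (d : ℕ) [NeZero d] :
    SimpleGraph (ProjMeasurement V d) where
  Adj E E' := ∀ v v', ¬ G.Adj v v' → E.proj v * E'.proj v' = 0
  symm := ⟨fun E E' h v v' hv => by
    have h1 := congrArg star (h v' v fun h' => hv h'.symm)
    rwa [star_mul, star_zero, (E.isProj v').isSelfAdjoint.star_eq,
      (E'.isProj v).isSelfAdjoint.star_eq] at h1⟩
  loopless := ⟨fun E h => by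
    have h0 : ∀ v, E.proj v = 0 := fun v => by
      rw [← (E.isProj v).isIdempotentElem.eq]
      exact h v v (G.loopless.irrefl v)
    have h1 := E.sum_eq_one
    rw [Finset.sum_eq_zero fun v _ => h0 v] at h1
    exact zero_ne_one h1⟩

/-- `G` has a quantum homomorphism to `H`: there is a homomorphism `G → M(H, d)` for some
positive integer `d`. -/
def QuantumHom {V W : Type*} [Fintype W] (G : SimpleGraph V) (H : SimpleGraph W) : Prop :=
  ∃ (d : ℕ) (_ : NeZero d), Nonempty (G →g measurementGraph H d)

/-- The quantum chromatic number: the least `n` with a quantum homomorphism from `G` to `Kₙ`. -/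
noncomputable def quantumChromaticNumber {V : Type*} (G : SimpleGraph V) : ℕ :=
  sInf {n : ℕ | QuantumHom G (SimpleGraph.completeGraph (Fin n))}

end HomProducts

namespace HomProducts

open Matrix Filter Topology
open scoped MatrixOrder Kronecker

/-! ### Real positive semidefinite matrices and spectral bounds for Kronecker products. -/

section RealPosSemidef

variable {V W : Type*} [Fintype V] [Fintype W]

/-! The projections of the product give `≤`. For `≥`, let `n` be the quantum chromatic number of the
product and suppose both strict vector chromatic numbers exceed some `t > n`. Conic duality
(`exists_dual_certificate`), after diagonal scaling, gives weighted adjacency matrices `A`, `B` of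
the factors with least eigenvalue at least `-1` and largest eigenvalues `α, β ≥ t - 1`
(`exists_weighted_adjacency`).

Then `A ⊗ₖ B` is a weighted adjacency matrix of the product, has `αβ` as a Rayleigh quotient at `x ⊗
y`, and has spectrum bounded below by `-max α β`. A quantum `n`-coloring gives a Gram matrix `P`,
equal to `c(n - 1)` on the diagonal and `-c` on edges (`exists_gram_of_quantumHom`). By the Schur
product theorem `(max α β • 1 + A ⊗ₖ B) ⊙ P` is positive semidefinite; testing it at `x ⊗ y` gives
`αβ ≤ max α β * (n - 1)`, that is `t - 1 ≤ min α β ≤ n - 1`, a contradiction. -/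

lemma posSemidef_real_iff {M : Matrix V V ℝ} :
    M.PosSemidef ↔ (∀ u v, M u v = M v u) ∧ ∀ x : V → ℝ, 0 ≤ ∑ u, ∑ v, x u * M u v * x v := by
  rw [posSemidef_iff_dotProduct_mulVec]
  refine and_congr ⟨fun h u v => ?_, fun h => ?_⟩ (forall_congr' fun x => ?_)
  · simpa using h.apply v u
  · ext u v
    simpa using h v u
  · simp only [dotProduct, mulVec, Finset.mul_sum, star_trivial, mul_assoc]

/-- The entries of a positive semidefinite matrix are bounded by its diagonal. -/
lemma abs_le_of_posSemidef {M : Matrix V V ℝ} (hM : M.PosSemidef) (u v : V) :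
    |M u v| ≤ M u u + M v v := by
  classical
  have key : ∀ s : ℝ, 0 ≤ M u u + s * M u v + s * M v u + s * s * M v v := by
    intro s
    have h := hM.dotProduct_mulVec_nonneg (Pi.single u 1 + Pi.single v s)
    simp only [star_trivial, mulVec_add, add_dotProduct, dotProduct_add,
      single_dotProduct, mulVec_single, Pi.smul_apply, col_apply,
      op_smul_eq_smul, smul_eq_mul] at h
    linarith
  have h1 := key 1
  have h2 := key (-1)
  have h3 := (posSemidef_real_iff.1 hM).1 u v
  have h4 := hM.diag_nonneg (i := u)
  have h5 := hM.diag_nonneg (i := v)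
  rw [abs_le]
  constructor <;> linarith

lemma isClosed_posSemidef : IsClosed {P : V → V → ℝ | (Matrix.of P).PosSemidef} := by
  simp only [posSemidef_real_iff, Set.ofPred_and, Set.ofPred_forall, of_apply]
  refine IsClosed.inter (isClosed_iInter fun u => isClosed_iInter fun v => ?_)
    (isClosed_iInter fun x => ?_)
  · exact isClosed_eq (by fun_prop) (by fun_prop)
  · exact isClosed_le (by fun_prop) (by fun_prop)

/-- A real square matrix attains the maximum of its Rayleigh quotient. -/
lemma exists_max_quadratic [Nonempty V] (A : Matrix V V ℝ) :
    ∃ x : V → ℝ, ∑ u, x u ^ 2 = 1 ∧ ∀ y : V → ℝ,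
      ∑ u, ∑ v, y u * A u v * y v ≤ (∑ u, ∑ v, x u * A u v * x v) * ∑ u, y u ^ 2 := by
  classical
  have hcomp : IsCompact {x : V → ℝ | ∑ u, x u ^ 2 = 1} := by
    refine (isCompact_univ_pi fun _ : V => isCompact_Icc (a := (-1 : ℝ)) (b := 1)).of_isClosed_subset
      (isClosed_eq (by fun_prop) (by fun_prop)) fun x hx u _ => ?_
    have h : x u ^ 2 ≤ ∑ w, x w ^ 2 :=
      Finset.single_le_sum (f := fun w => x w ^ 2) (fun w _ => sq_nonneg _) (Finset.mem_univ u)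
    rw [show ∑ w, x w ^ 2 = 1 from hx] at h
    exact abs_le.1 ((sq_le_one_iff_abs_le_one _).1 h)
  have hne : {x : V → ℝ | ∑ u, x u ^ 2 = 1}.Nonempty := by
    obtain ⟨u⟩ := ‹Nonempty V›
    exact ⟨Pi.single u 1, by simp [Pi.single_apply]⟩
  obtain ⟨x, hx, hmax⟩ := hcomp.exists_isMaxOn hne
    (f := fun x => ∑ u, ∑ v, x u * A u v * x v) (by fun_prop)
  refine ⟨x, hx, fun y => ?_⟩
  rcases (Finset.sum_nonneg fun u _ => sq_nonneg (y u)).eq_or_lt with h0 | hpos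
  · have hy : ∀ u, y u = 0 := fun u => by
      have := (Finset.sum_eq_zero_iff_of_nonneg fun u _ => sq_nonneg (y u)).1 h0.symm u
        (Finset.mem_univ u)
      exact pow_eq_zero_iff two_ne_zero |>.1 this
    simp [hy]
  · set s := ∑ u, y u ^ 2 with hs
    have hsq : √s * √s = s := Real.mul_self_sqrt hpos.le
    have hr : √s ≠ 0 := (Real.sqrt_pos.2 hpos).ne'
    have hmem : (fun u => y u / √s) ∈ {x : V → ℝ | ∑ u, x u ^ 2 = 1} := by
      simp only [Set.mem_ofPred_eq, div_pow, ← Finset.sum_div, ← hs]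
      rw [Real.sq_sqrt hpos.le, div_self hpos.ne']
    have h : (∑ u, ∑ v, y u / √s * A u v * (y v / √s)) ≤ ∑ u, ∑ v, x u * A u v * x v := hmax hmem
    have he : (∑ u, ∑ v, y u / √s * A u v * (y v / √s)) = (∑ u, ∑ v, y u * A u v * y v) / s := by
      simp only [Finset.sum_div]
      refine Finset.sum_congr rfl fun u _ => Finset.sum_congr rfl fun v _ => ?_
      rw [div_mul_eq_mul_div, div_mul_div_comm, hsq]
    rwa [he, div_le_iff₀ hpos] at h

/-- If the spectrum of `A` lies in `[-1, α]` and that of `B` in `[-1, β]`, then that of `A ⊗ₖ B`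
is bounded below by `-max α β`. -/
lemma posSemidef_smul_one_add_kronecker [DecidableEq V] [DecidableEq W]
    {A : Matrix V V ℝ} {B : Matrix W W ℝ} {α β m : ℝ}
    (hA : (1 + A).PosSemidef) (hB : (1 + B).PosSemidef)
    (hA' : (α • (1 : Matrix V V ℝ) - A).PosSemidef) (hB' : (β • (1 : Matrix W W ℝ) - B).PosSemidef)
    (hα : 0 ≤ α) (hβ : 0 ≤ β) (hαm : α ≤ m) (hβm : β ≤ m) :
    (m • (1 : Matrix (V × W) (V × W) ℝ) + A ⊗ₖ B).PosSemidef := by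
  -- Bilinear interpolation of `m + ab` over the rectangle `[-1, α] × [-1, β]`: the four
  -- coefficients are its values at the corners, all nonnegative.
  have key : m • (1 : Matrix (V × W) (V × W) ℝ) + A ⊗ₖ B = ((α + 1) * (β + 1))⁻¹ •
      ((1 + m) • ((α • (1 : Matrix V V ℝ) - A) ⊗ₖ (β • (1 : Matrix W W ℝ) - B)) +
       (m - β) • ((α • (1 : Matrix V V ℝ) - A) ⊗ₖ (1 + B)) +
       (m - α) • ((1 + A) ⊗ₖ (β • (1 : Matrix W W ℝ) - B)) +
       (m + α * β) • ((1 + A) ⊗ₖ (1 + B))) := by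
    have h1 : (α + 1) ≠ 0 := by positivity
    have h2 : (β + 1) ≠ 0 := by positivity
    rw [← one_kronecker_one (α := ℝ) (m := V) (n := W)]
    ext p q
    simp only [Matrix.add_apply, Matrix.sub_apply, Matrix.smul_apply, kroneckerMap_apply, smul_eq_mul]
    field_simp
    ring
  rw [key]
  refine PosSemidef.smul ?_ (by positivity)
  refine ((PosSemidef.add ?_ ?_).add ?_).add ?_
  · exact (hA'.kronecker hB').smul (by linarith)
  · exact (hA'.kronecker hB).smul (by linarith)
  · exact (hA.kronecker hB').smul (by linarith)
  · exact (hA.kronecker hB).smul (by nlinarith [mul_nonneg hα hβ])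

end RealPosSemidef

/-! ### Conic duality for strict vector colorings. -/

section Duality

variable {V : Type*}

/-- The partial matrices, specified on the diagonal and on the edges of `G`, that have a positive
semidefinite completion; the remaining entries are arbitrary. -/
def completableCone (G : SimpleGraph V) : Set (V → V → ℝ) :=
  {Q | ∃ P : V → V → ℝ, (Matrix.of P).PosSemidef ∧ ∀ u v, u = v ∨ G.Adj u v → Q u v = P u v}

lemma smul_mem_completableCone {G : SimpleGraph V} {Q : V → V → ℝ} (hQ : Q ∈ completableCone G)
    {c : ℝ} (hc : 0 ≤ c) : c • Q ∈ completableCone G := by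
  obtain ⟨P, hP, h⟩ := hQ
  exact ⟨c • P, hP.smul hc, fun u v huv => by simp [h u v huv]⟩

lemma convex_completableCone (G : SimpleGraph V) : Convex ℝ (completableCone G) := by
  rintro Q ⟨P, hP, h⟩ Q' ⟨P', hP', h'⟩ a b ha hb -
  exact ⟨a • P + b • P', (hP.smul ha).add (hP'.smul hb), fun u v huv => by
    simp [h u v huv, h' u v huv]⟩

variable [Fintype V]

/-- The diagonal is always specified and bounds every entry of a completion, so completions of a
convergent sequence stay in a compact box and subconverge. -/
lemma isClosed_completableCone (G : SimpleGraph V) : IsClosed (completableCone G) := by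
  refine isClosed_of_closure_subset fun Q hQ => ?_
  obtain ⟨q, hq, hlim⟩ := mem_closure_iff_seq_limit.1 hQ
  choose P hP hPq using hq
  have hentry : ∀ u v, Tendsto (fun n => q n u v) atTop (𝓝 (Q u v)) := fun u v =>
    tendsto_pi_nhds.1 (tendsto_pi_nhds.1 hlim u) v
  have hbdd : ∀ u, ∃ R, ∀ n, q n u u ≤ R := fun u =>
    let ⟨R, hR⟩ := (hentry u u).bddAbove_range
    ⟨R, fun n => hR ⟨n, rfl⟩⟩
  choose R hR using hbdd
  have hK : IsCompact (Set.pi Set.univ fun u : V => Set.pi Set.univ fun v : V =>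
      Set.Icc (-(R u + R v)) (R u + R v)) :=
    isCompact_univ_pi fun u => isCompact_univ_pi fun v => isCompact_Icc
  obtain ⟨P₀, -, s, hs, hPlim⟩ := hK.tendsto_subseq (x := P) fun n u _ v _ => by
    have h := abs_le_of_posSemidef (hP n) u v
    simp only [of_apply] at h
    rw [← hPq n u u (Or.inl rfl), ← hPq n v v (Or.inl rfl)] at h
    exact abs_le.1 (h.trans (add_le_add (hR u n) (hR v n)))
  refine ⟨P₀, isClosed_posSemidef.mem_of_tendsto hPlim (Eventually.of_forall fun n => hP _),
    fun u v huv => ?_⟩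
  refine tendsto_nhds_unique ((hentry u v).comp hs.tendsto_atTop) ?_
  refine (tendsto_pi_nhds.1 (tendsto_pi_nhds.1 hPlim u) v).congr fun n => ?_
  exact (hPq _ u v huv).symm

/-- A Gram matrix with unit diagonal and constant entries on edges yields a strict vector
coloring. -/
lemma exists_strictVectorColoring_of_posSemidef [Nonempty V] {G : SimpleGraph V} {k : ℝ}
    {P : Matrix V V ℝ} (hP : P.PosSemidef) (hdiag : ∀ u, P u u = 1)
    (hadj : ∀ u v, G.Adj u v → P u v = -(1 / (k - 1))) :
    ∃ (d : ℕ) (φ : V → Metric.sphere (0 : EuclideanSpace ℝ (Fin (d + 1))) 1),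
      IsStrictVectorColoring G k φ := by
  classical
  obtain ⟨B, hB⟩ := CStarAlgebra.nonneg_iff_eq_star_mul_self.mp hP.nonneg
  obtain ⟨d, hd⟩ := Nat.exists_eq_succ_of_ne_zero (Fintype.card_ne_zero (α := V))
  let e : V ≃ Fin (d + 1) := Fintype.equivFinOfCardEq hd
  let ψ : V → EuclideanSpace ℝ (Fin (d + 1)) := fun u => WithLp.toLp 2 fun i => B (e.symm i) u
  have hψ : ∀ u v, inner ℝ (ψ u) (ψ v) = P u v := fun u v => by
    rw [hB, star_eq_conjTranspose, mul_apply, PiLp.inner_apply, ← e.symm.sum_comp]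
    exact Finset.sum_congr rfl fun i _ => by simp [ψ, mul_comm]
  refine ⟨d, fun u => ⟨ψ u, ?_⟩, fun u v huv => by simpa only [hψ] using hadj u v huv⟩
  rw [mem_sphere_zero_iff_norm, norm_eq_sqrt_real_inner, hψ, hdiag, Real.sqrt_one]

/-- Strong duality for the strict vector chromatic number: if `G` has no strict vector
`k`-coloring, a matrix supported on the diagonal and the edges of `G` certifies it. -/
lemma exists_dual_certificate [Nonempty V] {G : SimpleGraph V} {k : ℝ} (hk : 1 < k)
    (hno : ¬ ∃ (d : ℕ) (φ : V → Metric.sphere (0 : EuclideanSpace ℝ (Fin (d + 1))) 1),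
      IsStrictVectorColoring G k φ) :
    ∃ M : Matrix V V ℝ, M.PosSemidef ∧ (∀ u v, u ≠ v → ¬ G.Adj u v → M u v = 0) ∧
      k * ∑ u, M u u < ∑ u, ∑ v, M u v := by
  classical
  -- The values of `b` at non-edges are immaterial to membership in the cone.
  set b : V → V → ℝ := fun u v => if u = v then 1 else -(1 / (k - 1)) with hb
  have hbC : b ∉ completableCone G := by
    rintro ⟨P, hP, h⟩
    refine hno (exists_strictVectorColoring_of_posSemidef hP (fun u => ?_) fun u v huv => ?_)
    · rw [of_apply, ← h u u (Or.inl rfl)]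
      simp [hb]
    · rw [of_apply, ← h u v (Or.inr huv)]
      simp [hb, huv.ne]
  obtain ⟨f, s, hf, hs⟩ := geometric_hahn_banach_closed_point (convex_completableCone G)
    (isClosed_completableCone G) hbC
  have hs0 : 0 < s := by simpa using hf 0 ⟨0, PosSemidef.zero, by simp⟩
  -- A functional bounded above on a cone is nonpositive there.
  have hfC : ∀ Q ∈ completableCone G, f Q ≤ 0 := by
    intro Q hQ
    by_contra! hpos
    have h := hf _ (smul_mem_completableCone hQ (div_pos hs0 hpos).le)
    rw [map_smul, smul_eq_mul, div_mul_cancel₀ _ hpos.ne'] at h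
    exact lt_irrefl _ h
  let c : V → V → ℝ := fun u v => f (Pi.single u (Pi.single v 1))
  have hfc : ∀ Q : V → V → ℝ, f Q = ∑ u, ∑ v, Q u v * c u v := by
    intro Q
    have hQ : Q = ∑ u, ∑ v, Q u v • (Pi.single u (Pi.single v 1) : V → V → ℝ) := by
      ext u v
      simp [Finset.sum_apply, Pi.single_apply, apply_ite, ite_apply]
    conv_lhs => rw [hQ]
    simp only [map_sum, map_smul, smul_eq_mul, c]
  have hc0 : ∀ u v, u ≠ v → ¬ G.Adj u v → c u v = 0 := by
    intro u v huv hadj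
    -- The cone contains the whole line spanned by an unspecified entry, so `f` vanishes on it.
    have hmem : ∀ r : ℝ, r • (Pi.single u (Pi.single v 1) : V → V → ℝ) ∈ completableCone G := by
      refine fun r => ⟨0, PosSemidef.zero, fun u' v' h' => ?_⟩
      have hne : ¬ (u' = u ∧ v' = v) := by
        rintro ⟨rfl, rfl⟩
        exact h'.elim huv hadj
      by_cases h1 : u' = u
      · subst h1
        have h2 : v' ≠ v := fun h => hne ⟨rfl, h⟩
        simp [h2]
      · simp [h1]
    have h1 := hfC _ (hmem 1)
    have h2 := hfC _ (hmem (-1))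
    simp only [map_smul, smul_eq_mul] at h1 h2
    simp only [c]
    linarith
  have hswap : ∀ g : V → V → ℝ, ∑ u, ∑ v, g v u = ∑ u, ∑ v, g u v := fun g => Finset.sum_comm
  -- Nothing makes `f` symmetric, so its coefficients are symmetrized. Positivity comes from `f ≤ 0`
  -- on rank-one matrices, the strict inequality from `f b > 0`.
  refine ⟨Matrix.of fun u v => -(c u v + c v u), posSemidef_real_iff.2
    ⟨fun u v => by simp [add_comm], fun x => ?_⟩, fun u v huv hadj => ?_, ?_⟩
  · have h := hfC (fun u v => x u * x v) ⟨fun u v => x u * x v, ?_, fun _ _ _ => rfl⟩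
    · rw [hfc] at h
      have e1 : ∑ u, ∑ v, x u * (Matrix.of fun u v => -(c u v + c v u)) u v * x v =
          -(∑ u, ∑ v, x u * x v * c u v) - ∑ u, ∑ v, x v * x u * c v u := by
        simp only [of_apply, ← Finset.sum_neg_distrib, ← Finset.sum_sub_distrib]
        refine Finset.sum_congr rfl fun u _ => Finset.sum_congr rfl fun v _ => by ring
      rw [e1, hswap fun u v => x u * x v * c u v]
      linarith
    · have := posSemidef_vecMulVec_self_star x
      rwa [star_trivial] at this
  · simp [hc0 u v huv hadj, hc0 v u huv.symm fun h => hadj h.symm]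
  · have h : 0 < f b := hs0.trans hs
    have e1 : f b = (k / (k - 1)) * ∑ u, c u u - (1 / (k - 1)) * ∑ u, ∑ v, c u v := by
      have hk' : k - 1 ≠ 0 := by linarith
      have e2 : ∀ u v, b u v * c u v =
          (if u = v then k / (k - 1) * c u v else 0) - 1 / (k - 1) * c u v := by
        intro u v
        by_cases huv : u = v
        · simp only [hb, huv, if_true]
          field_simp
        · simp [hb, huv]
      rw [hfc]
      simp only [e2, Finset.sum_sub_distrib, Finset.sum_ite_eq, Finset.mem_univ, if_true,
        Finset.mul_sum]
    rw [e1, div_mul_eq_mul_div, div_mul_eq_mul_div, ← sub_div, one_mul] at h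
    have h' : 0 < k * ∑ u, c u u - ∑ u, ∑ v, c u v := by
      rwa [div_pos_iff_of_pos_right (by linarith)] at h
    simp only [of_apply, Finset.sum_neg_distrib, Finset.sum_add_distrib, hswap c]
    linarith

/-- A weighted adjacency matrix of `G` with least eigenvalue at least `-1` whose largest
eigenvalue `α` is at least `t - 1`. -/
lemma exists_weighted_adjacency [DecidableEq V] {G : SimpleGraph V} {t : ℝ} (ht : 1 < t)
    (htG : t < strictVectorChromaticNumber G) :
    ∃ (A : Matrix V V ℝ) (α : ℝ) (x : V → ℝ), (∀ u v, ¬ G.Adj u v → A u v = 0) ∧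
      (1 + A).PosSemidef ∧ (α • (1 : Matrix V V ℝ) - A).PosSemidef ∧ t - 1 ≤ α ∧
      ∑ u, x u ^ 2 = 1 ∧ ∑ u, ∑ v, x u * A u v * x v = α := by
  have hno : ¬ ∃ (d : ℕ) (φ : V → Metric.sphere (0 : EuclideanSpace ℝ (Fin (d + 1))) 1),
      IsStrictVectorColoring G t φ := fun h =>
    htG.not_ge (csInf_le ⟨1, fun k hk => hk.1.le⟩ ⟨ht, h⟩)
  have hV : Nonempty V := by
    by_contra hV
    rw [not_nonempty_iff] at hV
    exact hno ⟨0, fun u => isEmptyElim u, fun u => isEmptyElim u⟩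
  obtain ⟨M, hM, hsupp, hlt⟩ := exists_dual_certificate ht hno
  set n : ℝ := (Fintype.card V : ℝ)
  have hn : 0 < n := by simp [n, Fintype.card_pos]
  -- The shift by `ε` makes the diagonal positive, so it can be scaled to `1`; this `ε` spends half
  -- of the slack.
  obtain ⟨ε, hε, hεlt⟩ : ∃ ε : ℝ, 0 < ε ∧ t * (∑ u, M u u + ε * n) < ∑ u, ∑ v, M u v := by
    refine ⟨(∑ u, ∑ v, M u v - t * ∑ u, M u u) / (2 * (t * n)), ?_, ?_⟩
    · exact div_pos (sub_pos.2 hlt) (by positivity)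
    · have htn : t * n ≠ 0 := by positivity
      have : t * (∑ u, M u u + (∑ u, ∑ v, M u v - t * ∑ u, M u u) / (2 * (t * n)) * n) =
        (∑ u, ∑ v, M u v + t * ∑ u, M u u) / 2 := by
        field_simp
        ring
      rw [this]
      linarith
  have hN : (M + ε • (1 : Matrix V V ℝ)).PosSemidef := hM.add (PosSemidef.one.smul hε.le)
  set D : V → ℝ := fun u => M u u + ε with hD
  have hDpos : ∀ u, 0 < D u := fun u => add_pos_of_nonneg_of_pos hM.diag_nonneg hε
  set r : V → ℝ := fun u => √(D u) with hr
  have hrpos : ∀ u, 0 < r u := fun u => Real.sqrt_pos.2 (hDpos u)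
  have hrr : ∀ u, r u * r u = D u := fun u => Real.mul_self_sqrt (hDpos u).le
  let A : Matrix V V ℝ := Matrix.of fun u v => if u = v then 0 else (r u)⁻¹ * M u v * (r v)⁻¹
  have hA1 : 1 + A = (diagonal fun u => (r u)⁻¹)ᴴ * (M + ε • (1 : Matrix V V ℝ)) *
      diagonal fun u => (r u)⁻¹ := by
    ext u v
    rw [diagonal_conjTranspose, mul_diagonal, diagonal_mul]
    by_cases huv : u = v
    · subst huv
      have h1 := hrr u
      have h2 := (hrpos u).ne'
      simp only [Matrix.add_apply, one_apply_eq, A, of_apply, if_true, Matrix.smul_apply,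
        star_trivial, smul_eq_mul, mul_one, add_zero]
      rw [show M u u + ε = r u * r u from h1.symm]
      field_simp
    · simp [A, huv]
  have hA : (1 + A).PosSemidef := hA1 ▸ hN.conjTranspose_mul_mul_same _
  obtain ⟨x, hx, hmax⟩ := exists_max_quadratic A
  have hsymm := (posSemidef_real_iff.1 hA).1
  have hAsymm : ∀ u v, A u v = A v u := fun u v => by
    have := hsymm u v
    simp only [Matrix.add_apply, one_apply, eq_comm (a := v)] at this
    linarith
  refine ⟨A, _, x, fun u v huv => ?_, hA, posSemidef_real_iff.2 ⟨fun u v => ?_, fun y => ?_⟩, ?_,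
    hx, rfl⟩
  · by_cases h : u = v
    · simp [A, h]
    · simp [A, h, hsupp u v h huv]
  · simp only [Matrix.sub_apply, Matrix.smul_apply, one_apply, hAsymm u v, eq_comm (a := u)]
  · have h := hmax y
    have e : ∀ a : ℝ, ∑ u, ∑ v, y u * (a • (1 : Matrix V V ℝ) - A) u v * y v =
        a * ∑ u, y u ^ 2 - ∑ u, ∑ v, y u * A u v * y v := by
      intro a
      simp only [Matrix.sub_apply, Matrix.smul_apply, one_apply, smul_eq_mul, mul_sub, sub_mul,
        Finset.sum_sub_distrib, mul_ite, ite_mul, mul_one, mul_zero, zero_mul, Finset.sum_ite_eq,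
        Finset.mem_univ, if_true, Finset.mul_sum]
      congr 1
      exact Finset.sum_congr rfl fun u _ => by ring
    rw [e]
    linarith
  -- Testing at `r`, the square roots of the shifted diagonal, undoes the scaling and recovers the
  -- entry sum of `M`.
  · have h := hmax r
    have hr2 : ∑ u, r u ^ 2 = ∑ u, M u u + ε * n := by
      simp only [sq, hrr, hD, Finset.sum_add_distrib]
      simp [n, mul_comm]
    have hq : ∑ u, ∑ v, r u * A u v * r v = ∑ u, ∑ v, M u v - ∑ u, M u u := by
      have e : ∀ u v, r u * A u v * r v = M u v - if u = v then M u v else 0 := by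
        intro u v
        have h1 := (hrpos u).ne'
        have h2 := (hrpos v).ne'
        by_cases huv : u = v
        · simp [A, huv]
        · simp only [A, of_apply, huv, if_false, sub_zero]
          field_simp
      simp only [e, Finset.sum_sub_distrib, Finset.sum_ite_eq, Finset.mem_univ, if_true]
    rw [hr2, hq] at h
    have htr : 0 ≤ ∑ u, M u u := Finset.sum_nonneg fun u _ => hM.diag_nonneg
    have hpos : 0 < ∑ u, M u u + ε * n := by positivity
    have hen : 0 < ε * n := by positivity
    refine le_of_mul_le_mul_right ?_ hpos
    linarith

end Duality

/-! ### Quantum colorings and their Gram matrices. -/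

section Quantum

lemma one_le_of_quantumHom {Z : Type*} [Nonempty Z] {X : SimpleGraph Z} {n : ℕ}
    (h : QuantumHom X (SimpleGraph.completeGraph (Fin n))) : 1 ≤ n := by
  obtain ⟨d, hd, ⟨f⟩⟩ := h
  rcases Nat.eq_zero_or_pos n with rfl | hn
  · obtain ⟨z⟩ := ‹Nonempty Z›
    have := (f z).sum_eq_one
    rw [Fin.sum_univ_zero] at this
    exact absurd this zero_ne_one
  · exact hn

lemma QuantumHom.comp {Z Y U : Type*} [Fintype U] {X : SimpleGraph Z} {X' : SimpleGraph Y}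
    {K : SimpleGraph U} (h : QuantumHom X' K) (g : X →g X') : QuantumHom X K :=
  let ⟨d, hd, ⟨f⟩⟩ := h
  ⟨d, hd, ⟨f.comp g⟩⟩

/-- A homomorphism is a quantum homomorphism, with one-dimensional measurements. -/
lemma quantumHom_of_hom {Z U : Type*} [Fintype U] {X : SimpleGraph Z} {K : SimpleGraph U}
    (g : X →g K) : QuantumHom X K := by
  classical
  refine ⟨1, inferInstance, ⟨⟨fun z => ⟨fun i => if i = g z then 1 else 0, fun i => ?_, ?_⟩, ?_⟩⟩⟩
  · split_ifs
    · exact IsStarProjection.one _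
    · exact IsStarProjection.zero _
  · simp
  · intro z z' hz i j hij
    by_cases h1 : i = g z
    · by_cases h2 : j = g z'
      · exact absurd (g.map_adj hz) (h1 ▸ h2 ▸ hij)
      · simp [h2]
    · simp [h1]

lemma exists_quantumHom {Z : Type*} [Finite Z] (X : SimpleGraph Z) :
    ∃ n, QuantumHom X (SimpleGraph.completeGraph (Fin n)) := by
  obtain ⟨n, ⟨e⟩⟩ := Finite.exists_equiv_fin Z
  exact ⟨n, quantumHom_of_hom ⟨e, fun h => e.injective.ne h.ne⟩⟩

lemma quantumHom_quantumChromaticNumber {Z : Type*} [Finite Z] (X : SimpleGraph Z) :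
    QuantumHom X (SimpleGraph.completeGraph (Fin (quantumChromaticNumber X))) :=
  Nat.sInf_mem (exists_quantumHom X)

lemma quantumChromaticNumber_le {Z : Type*} {X : SimpleGraph Z} {n : ℕ}
    (h : QuantumHom X (SimpleGraph.completeGraph (Fin n))) : quantumChromaticNumber X ≤ n :=
  Nat.sInf_le h

/-- Exhibits the trace pairing as a Euclidean inner product of real and imaginary parts, so traces
yield real Gram matrices. -/
lemma trace_mul_re {d : ℕ} {A B : Matrix (Fin d) (Fin d) ℂ} (hB : IsSelfAdjoint B) :
    (A * B).trace.re = ∑ a, ∑ b, ((A a b).re * (B a b).re + (A a b).im * (B a b).im) := by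
  simp only [trace, diag_apply, mul_apply, Complex.re_sum]
  refine Finset.sum_congr rfl fun a _ => Finset.sum_congr rfl fun b _ => ?_
  have h : B b a = star (B a b) := by
    conv_lhs => rw [← hB.star_eq]
    rfl
  rw [h]
  simp

/-- A quantum `n`-coloring yields, up to scaling, the Gram matrix of a strict vector
`n`-coloring. -/
lemma exists_gram_of_quantumHom {Z : Type*} [Fintype Z] [Nonempty Z] {X : SimpleGraph Z} {n : ℕ}
    (h : QuantumHom X (SimpleGraph.completeGraph (Fin n))) :
    ∃ (P : Matrix Z Z ℝ) (c : ℝ), 0 < c ∧ P.PosSemidef ∧ (∀ p, P p p = c * (n - 1)) ∧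
      ∀ p q, X.Adj p q → P p q = -c := by
  have hn : 1 ≤ n := one_le_of_quantumHom h
  have hn0 : (n : ℂ) ≠ 0 := by exact_mod_cast (by omega : n ≠ 0)
  have hn0' : (n : ℝ) ≠ 0 := by exact_mod_cast (by omega : n ≠ 0)
  have hnpos : (0 : ℝ) < n := by exact_mod_cast hn
  obtain ⟨d, hd, ⟨f⟩⟩ := h
  have hdpos : (0 : ℝ) < d := by exact_mod_cast Nat.pos_of_ne_zero hd.out
  -- Centering subtracts `d / n` from every trace pairing: `d` on the diagonal becomes `(d / n)(n -
  -- 1)`, and `0` on edges becomes `-d / n`.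
  let F : Z → Fin n → Matrix (Fin d) (Fin d) ℂ := fun p i =>
    (f p).proj i - (n : ℂ)⁻¹ • (1 : Matrix (Fin d) (Fin d) ℂ)
  have hF : ∀ p i, IsSelfAdjoint (F p i) := fun p i => by
    refine ((f p).isProj i).isSelfAdjoint.sub (IsSelfAdjoint.smul ?_ (IsSelfAdjoint.one _))
    simp [isSelfAdjoint_iff]
  have htr : ∀ p, ∑ i, ((f p).proj i).trace = (d : ℂ) := fun p => by
    rw [← trace_sum, (f p).sum_eq_one, trace_one, Fintype.card_fin]
  have hsum : ∀ p q, ∑ i, (F p i * F q i).trace =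
      ∑ i, ((f p).proj i * (f q).proj i).trace - (d : ℂ) / n := by
    intro p q
    have e : ∀ i, (F p i * F q i).trace = ((f p).proj i * (f q).proj i).trace
        - (n : ℂ)⁻¹ * ((f p).proj i).trace - (n : ℂ)⁻¹ * ((f q).proj i).trace
        + (n : ℂ)⁻¹ * (n : ℂ)⁻¹ * d := by
      intro i
      simp only [F, sub_mul, mul_sub, trace_sub, smul_mul_assoc, mul_smul_comm, one_mul, mul_one,
        trace_smul, trace_one, Fintype.card_fin, smul_eq_mul]
      ring
    simp only [e, Finset.sum_add_distrib, Finset.sum_sub_distrib, ← Finset.mul_sum, htr,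
      Finset.sum_const, Finset.card_univ, Fintype.card_fin, nsmul_eq_mul]
    field_simp
    ring
  refine ⟨Matrix.of fun p q => ∑ i, (F p i * F q i).trace.re, d / n, div_pos hdpos hnpos,
    posSemidef_real_iff.2 ⟨fun p q => ?_, fun x => ?_⟩, fun p => ?_, fun p q hpq => ?_⟩
  · simp only [of_apply, trace_mul_comm (F p _)]
  · have e : ∑ p, ∑ q, x p * (Matrix.of fun p q => ∑ i, (F p i * F q i).trace.re) p q * x q =
        ∑ i, ∑ a, ∑ b, ((∑ p, x p * (F p i a b).re) ^ 2 + (∑ p, x p * (F p i a b).im) ^ 2) := by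
      simp only [of_apply, trace_mul_re (hF _ _), Finset.mul_sum, Finset.sum_mul, sq]
      simp only [← Finset.sum_add_distrib]
      have hcomm : ∀ (g : Z → Fin n → Fin d → Fin d → ℝ),
          ∑ q, ∑ i, ∑ a, ∑ b, g q i a b = ∑ i, ∑ a, ∑ b, ∑ q, g q i a b := by
        intro g
        rw [Finset.sum_comm]
        refine Finset.sum_congr rfl fun i _ => ?_
        rw [Finset.sum_comm]
        refine Finset.sum_congr rfl fun a _ => ?_
        rw [Finset.sum_comm]
      simp only [hcomm]
      refine Finset.sum_congr rfl fun i _ => Finset.sum_congr rfl fun a _ =>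
        Finset.sum_congr rfl fun b _ => ?_
      rw [Finset.sum_comm]
      refine Finset.sum_congr rfl fun p _ => Finset.sum_congr rfl fun q _ => ?_
      ring
    rw [e]
    positivity
  · have h1 : ∑ i, ((f p).proj i * (f p).proj i).trace = (d : ℂ) := by
      simp only [((f p).isProj _).isIdempotentElem.eq, htr]
    have h2 := congrArg Complex.re (hsum p p)
    rw [h1, Complex.re_sum] at h2
    rw [of_apply, h2, Complex.sub_re, Complex.natCast_re, ← Complex.ofReal_natCast d,
      ← Complex.ofReal_natCast n, ← Complex.ofReal_div, Complex.ofReal_re]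
    field_simp
  · have h1 : ∑ i, ((f p).proj i * (f q).proj i).trace = (0 : ℂ) := by
      refine Finset.sum_eq_zero fun i _ => ?_
      rw [f.map_adj hpq i i (SimpleGraph.irrefl _), trace_zero]
    have h2 := congrArg Complex.re (hsum p q)
    rw [h1, Complex.re_sum] at h2
    rw [of_apply, h2, zero_sub, Complex.neg_re, ← Complex.ofReal_natCast d,
      ← Complex.ofReal_natCast n, ← Complex.ofReal_div, Complex.ofReal_re]

end Quantum

/-! ### The lower bound for the categorical product. -/

section Product

variable {V W : Type*}

lemma quadratic_kronecker [Fintype V] [Fintype W] (A : Matrix V V ℝ) (B : Matrix W W ℝ)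
    (x : V → ℝ) (y : W → ℝ) :
    ∑ p : V × W, ∑ q : V × W, x p.1 * y p.2 * (A ⊗ₖ B) p q * (x q.1 * y q.2) =
      (∑ u, ∑ v, x u * A u v * x v) * ∑ u, ∑ v, y u * B u v * y v := by
  simp only [Finset.sum_mul_sum, Fintype.sum_prod_type, kroneckerMap_apply]
  refine Finset.sum_congr rfl fun u _ => Finset.sum_congr rfl fun w _ =>
    Finset.sum_congr rfl fun v _ => Finset.sum_congr rfl fun z _ => by ring

lemma le_of_quantumHom_catProd [Finite V] [Finite W] {G : SimpleGraph V} {H : SimpleGraph W}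
    [Nonempty V] [Nonempty W] {t : ℝ} (ht : 1 < t) (hG : t < strictVectorChromaticNumber G)
    (hH : t < strictVectorChromaticNumber H) {n : ℕ}
    (h : QuantumHom (catProd G H) (SimpleGraph.completeGraph (Fin n))) : t ≤ n := by
  classical
  have := Fintype.ofFinite V
  have := Fintype.ofFinite W
  obtain ⟨A, α, x, hAsupp, hA, hA', htα, hx, hxα⟩ := exists_weighted_adjacency ht hG
  obtain ⟨B, β, y, hBsupp, hB, hB', htβ, hy, hyβ⟩ := exists_weighted_adjacency ht hH
  obtain ⟨P, c, hc, hP, hdiag, hadj⟩ := exists_gram_of_quantumHom h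
  have hα : 0 < α := by linarith
  have hβ : 0 < β := by linarith
  set m := max α β with hm
  have hN := posSemidef_smul_one_add_kronecker hA hB hA' hB' hα.le hβ.le
    (hm ▸ le_max_left α β) (hm ▸ le_max_right α β)
  have hq := (posSemidef_real_iff.1 (hN.hadamard hP)).2 fun p => x p.1 * y p.2
  have hentry : ∀ p q : V × W,
      -- The first factor vanishes off the diagonal and the edges, so the unknown entries of `P`
      -- drop out.
      x p.1 * y p.2 * ((m • (1 : Matrix (V × W) (V × W) ℝ) + A ⊗ₖ B) ⊙ P) p q * (x q.1 * y q.2) =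
      (if p = q then m * (c * (n - 1)) * (x p.1 ^ 2 * y p.2 ^ 2) else 0) -
        c * (x p.1 * y p.2 * (A ⊗ₖ B) p q * (x q.1 * y q.2)) := by
    intro p q
    have h1 : (A ⊗ₖ B) p q * P p q = -c * (A ⊗ₖ B) p q := by
      by_cases hpq : (catProd G H).Adj p q
      · rw [hadj p q hpq, mul_comm]
      · have : (A ⊗ₖ B) p q = 0 := by
          rw [kroneckerMap_apply]
          by_cases h1 : G.Adj p.1 q.1
          · rw [hBsupp _ _ fun h2 => hpq ⟨h1, h2⟩, mul_zero]
          · rw [hAsupp _ _ h1, zero_mul]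
        rw [this, zero_mul, mul_zero]
    rw [hadamard_apply, Matrix.add_apply, add_mul, h1, Matrix.smul_apply, one_apply]
    by_cases hpq : p = q
    · subst hpq
      simp only [if_true, hdiag, smul_eq_mul]
      ring
    · simp only [hpq, if_false, smul_eq_mul]
      ring
  simp only [hentry, Finset.sum_sub_distrib, Finset.sum_ite_eq, Finset.mem_univ, if_true,
    ← Finset.mul_sum, quadratic_kronecker, hxα, hyβ] at hq
  simp only [Fintype.sum_prod_type, ← Finset.sum_mul_sum, hx, hy] at hq
  have h1 : α * β ≤ m * (n - 1) := by
    refine le_of_mul_le_mul_left ?_ hc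
    linarith
  have h2 : α * β = m * min α β := (max_mul_min α β).symm
  have hmpos : 0 < m := lt_max_of_lt_left hα
  rw [h2] at h1
  have h3 : min α β ≤ n - 1 := le_of_mul_le_mul_left h1 hmpos
  have h4 : t - 1 ≤ min α β := le_min htα htβ
  linarith

/-- The empty graph is excluded, since its strict vector chromatic number is `1`. -/
lemma nonempty_of_quantumChromaticNumber_eq {G : SimpleGraph V}
    (h : (quantumChromaticNumber G : ℝ) = strictVectorChromaticNumber G) : Nonempty V := by
  by_contra hV
  rw [not_nonempty_iff] at hV
  have h0 : quantumChromaticNumber G = 0 := Nat.le_zero.1 <| quantumChromaticNumber_le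
    (quantumHom_of_hom ⟨fun u => isEmptyElim u, fun {u} => isEmptyElim u⟩)
  have h1 : 1 ≤ strictVectorChromaticNumber G :=
    le_csInf ⟨2, one_lt_two, 0, fun u => isEmptyElim u, fun u => isEmptyElim u⟩
      fun k hk => hk.1.le
  rw [← h, h0] at h1
  norm_num at h1

end Product

end HomProducts

theorem mainTheorem7 {V W : Type*} [Finite V] [Finite W]
    (G : SimpleGraph V) (H : SimpleGraph W)
    (hG : (HomProducts.quantumChromaticNumber G : ℝ) =
      HomProducts.strictVectorChromaticNumber G)
    (hH : (HomProducts.quantumChromaticNumber H : ℝ) =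
      HomProducts.strictVectorChromaticNumber H) :
    HomProducts.quantumChromaticNumber (HomProducts.catProd G H) =
      min (HomProducts.quantumChromaticNumber G) (HomProducts.quantumChromaticNumber H) := by
  open HomProducts in
  have := nonempty_of_quantumChromaticNumber_eq hG
  have := nonempty_of_quantumChromaticNumber_eq hH
  have hGH := quantumHom_quantumChromaticNumber (catProd G H)
  refine le_antisymm (le_min ?_ ?_) ?_
  · exact quantumChromaticNumber_le
      ((quantumHom_quantumChromaticNumber G).comp ⟨Prod.fst, fun h => h.1⟩)
  · exact quantumChromaticNumber_le
      ((quantumHom_quantumChromaticNumber H).comp ⟨Prod.snd, fun h => h.2⟩)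
  · set n := quantumChromaticNumber (catProd G H)
    have hn : 1 ≤ n := one_le_of_quantumHom hGH
    by_contra! hlt
    obtain ⟨hnG, hnH⟩ := lt_min_iff.1 hlt
    have hn' : (1 : ℝ) ≤ n := by exact_mod_cast hn
    have hnG' : (n : ℝ) + 1 ≤ strictVectorChromaticNumber G := by
      rw [← hG]
      exact_mod_cast hnG
    have hnH' : (n : ℝ) + 1 ≤ strictVectorChromaticNumber H := by
      rw [← hH]
      exact_mod_cast hnH
    -- By integrality both parameters are at least `n + 1`, leaving room for `t` strictly between;
    -- `1 ≤ n` ensures `t > 1`.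
    have := le_of_quantumHom_catProd (t := n + 1 / 2) (by linarith) (by linarith) (by linarith) hGH
    linarith
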